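/- Let $\tau$ be an infinite cardinal. A family $\{D_i : i\in I\}$ of subsets of a topological space $X$ is called discrete if every point of $X$ has a neighbourhood which meets $D_i$ for at most one index $i\in I$. The space $X$ is called $\tau$-collectionwise normal if it is a $T_1$-space and for every discrete collection $\mathscr{D}$ of closed subsets of $X$ with $|\mathscr{D}|\leq\tau$ there is a discrete family $\{U_D : D\in\mathscr{D}\}$ of open subsets of $X$ such that $D\subset U_D$ for every $D\in\mathscr{D}$. For a Banach space $E$ over $\mathbb{R}$, let $w(E)$ be its topological weight, i.e. the least cardinality of a base of its norm topology, and let $\mathscr{C}'(E)$ be the collection consisting of all nonempty compact subsets of $E$ and of $E$ itself. A mapping $\varphi:X\to\mathscr{C}'(E)$ is called l.s.c. (lower semi-continuous) if the set $\{x\in X : \varphi(x)\cap U\neq\emptyset\}$ is open in $X$ for every open $U\subset E$. Theorem 3.1. Let $X$ be a $\tau$-collectionwise normal space, let $E$ be a Banach space with $w(E)\leq\tau$, and let $\varphi: X\to\mathscr{C}'(E)$ be an l.s.c. mapping such that $\varphi(x)$ is convex for every $x\in X$. Then $\varphi$ has a continuous selection, i.e. there is a continuous map $f:X\to E$ such that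 $f(x)\in\varphi(x)$ for every $x\in X$. -/

import Mathlib

universe u v w

/-- An indexed family of subsets of `X` is discrete if every point of `X` has a neighbourhood
meeting at most one member of the family (members with different indices count as different). -/
def IsDiscreteFamily {X : Type u} [TopologicalSpace X] {ι : Type v} (D : ι → Set X) : Prop :=
  ∀ x : X, ∃ N ∈ nhds x, ∀ i j : ι, (D i ∩ N).Nonempty → (D j ∩ N).Nonempty → i = j

/-- `X` is `τ`-collectionwise normal: it is `T₁`, and every discrete collection `𝒟` of at most `τ`
closed subsets of `X` has a discrete family `U D`, `D ∈ 𝒟`, of open sets with `D ⊆ U D`. -/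
structure IsCollectionwiseNormal (τ : Cardinal.{w}) (X : Type u) [TopologicalSpace X] : Prop where
  t1 : T1Space X
  exists_open_expansion : ∀ 𝒟 : Set (Set X),
    Cardinal.lift.{w} (Cardinal.mk 𝒟) ≤ Cardinal.lift.{u} τ →
    (∀ D ∈ 𝒟, IsClosed D) →
    IsDiscreteFamily (fun D : 𝒟 => (D : Set X)) →
    ∃ U : 𝒟 → Set X, (∀ D : 𝒟, IsOpen (U D)) ∧ IsDiscreteFamily U ∧ ∀ D : 𝒟, (D : Set X) ⊆ U D

/-- The topological weight: the least cardinality of a base of the topology. -/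
noncomputable def topologicalWeight (E : Type v) [TopologicalSpace E] : Cardinal.{v} :=
  sInf {κ | ∃ B : Set (Set E), TopologicalSpace.IsTopologicalBasis B ∧ Cardinal.mk B = κ}

/-- The nonempty compact subsets of `E` (for Hausdorff `E` these are closed). -/
def nonemptyCompactSets (E : Type v) [TopologicalSpace E] : Set (Set E) :=
  {S | S.Nonempty ∧ IsCompact S}

/-- The nonempty compact subsets of `E`, together with the whole space `E`. -/
def nonemptyCompactSetsOrUniv (E : Type v) [TopologicalSpace E] : Set (Set E) :=
  nonemptyCompactSets E ∪ {Set.univ}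

open Set Filter Topology

/-! ### Point-finite open families in collectionwise normal spaces -/

section CollectionwiseNormal

variable {X : Type u} [TopologicalSpace X] {ι : Type v} {τ : Cardinal.{w}}

/-! Michael's iteration: `f (n+1)` is an approximate selection of `φ x ∩ ball (f n x) (1/2)^n`, and
the uniform limit selects from the closed values `φ x`. For one approximation, pull back a locally
finite cover of `E` by small open sets. The resulting open family is point-finite where the values
are relatively compact; elsewhere the previous map already selects, so the family is needed only on
the closed set where that map fails. There, collectionwise normality replaces paracompactness:
points are sorted by the exact set of members containing them, which gives countably many locally
constant choices on cozero sets. Countable cozero covers have locally finite refinements, so a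
partition of unity glues the choices to the old map inside convex sets. -/

/-- In a discrete indexed family only the empty set can repeat, so the expansion of the range can be
reindexed once empty members are given empty neighbourhoods. -/
theorem IsCollectionwiseNormal.exists_indexed_open_expansion (hX : IsCollectionwiseNormal τ X)
    (hι : Cardinal.lift.{w} (Cardinal.mk ι) ≤ Cardinal.lift.{v} τ) {C : ι → Set X}
    (hC : ∀ i, IsClosed (C i)) (hd : IsDiscreteFamily C) :
    ∃ U : ι → Set X, (∀ i, IsOpen (U i)) ∧ IsDiscreteFamily U ∧ ∀ i, C i ⊆ U i := by
  have hcard : Cardinal.lift.{w} (Cardinal.mk (range C)) ≤ Cardinal.lift.{u} τ := by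
    rw [← Cardinal.lift_le.{v}]
    calc Cardinal.lift.{v} (Cardinal.lift.{w} (Cardinal.mk (range C)))
        = Cardinal.lift.{w} (Cardinal.lift.{v} (Cardinal.mk (range C))) := by
          simp only [Cardinal.lift_lift]
      _ ≤ Cardinal.lift.{w} (Cardinal.lift.{u} (Cardinal.mk ι)) :=
          Cardinal.lift_le.2 Cardinal.mk_range_le_lift
      _ = Cardinal.lift.{u} (Cardinal.lift.{w} (Cardinal.mk ι)) := by
          simp only [Cardinal.lift_lift]
      _ ≤ Cardinal.lift.{u} (Cardinal.lift.{v} τ) := Cardinal.lift_le.2 hι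
      _ = Cardinal.lift.{v} (Cardinal.lift.{u} τ) := by
          simp only [Cardinal.lift_lift]
  have hinj : ∀ i j, (C i).Nonempty → C i = C j → i = j := by
    rintro i j ⟨x, hx⟩ hij
    obtain ⟨N, hN, h⟩ := hd x
    exact h i j ⟨x, hx, mem_of_mem_nhds hN⟩ ⟨x, hij ▸ hx, mem_of_mem_nhds hN⟩
  obtain ⟨U, hUo, hUd, hU⟩ := hX.exists_open_expansion (range C) hcard
    (by rintro _ ⟨i, rfl⟩; exact hC i) (by
      intro x
      obtain ⟨N, hN, h⟩ := hd x
      refine ⟨N, hN, ?_⟩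
      rintro ⟨_, i, rfl⟩ ⟨_, j, rfl⟩ hi hj
      exact Subtype.ext (congrArg C (h i j hi hj)))
  refine ⟨fun i => {x | (C i).Nonempty ∧ x ∈ U ⟨C i, i, rfl⟩}, fun i => ?_, fun x => ?_,
    fun i x hx => ⟨⟨x, hx⟩, hU ⟨C i, i, rfl⟩ hx⟩⟩
  · by_cases h : (C i).Nonempty
    · simpa [h] using hUo ⟨C i, i, rfl⟩
    · simp [h]
  · obtain ⟨N, hN, h⟩ := hUd x
    refine ⟨N, hN, ?_⟩
    rintro i j ⟨y, ⟨hi, hy⟩, hyN⟩ ⟨z, ⟨-, hz⟩, hzN⟩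
    exact hinj i j hi (congrArg Subtype.val (h ⟨C i, i, rfl⟩ ⟨C j, j, rfl⟩
      ⟨y, hy, hyN⟩ ⟨z, hz, hzN⟩))

theorem IsDiscreteFamily.eq_of_mem {U : ι → Set X} (hU : IsDiscreteFamily U) {i j : ι} {x : X}
    (hi : x ∈ U i) (hj : x ∈ U j) : i = j := by
  obtain ⟨N, hN, h⟩ := hU x
  exact h i j ⟨x, hi, mem_of_mem_nhds hN⟩ ⟨x, hj, mem_of_mem_nhds hN⟩

theorem IsCollectionwiseNormal.normalSpace (hX : IsCollectionwiseNormal τ X)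
    (hτ : Cardinal.aleph0 ≤ τ) : NormalSpace X := by
  refine ⟨fun s t hs ht hst => ?_⟩
  have hcard : Cardinal.lift.{w} (Cardinal.mk Bool) ≤ Cardinal.lift.{0} τ := by
    rw [Cardinal.lift_uzero]
    exact (Cardinal.lift_lt_aleph0.2 (Cardinal.mk_lt_aleph0)).le.trans hτ
  obtain ⟨U, hUo, hUd, hU⟩ := hX.exists_indexed_open_expansion hcard
    (C := fun b => cond b s t) (by rintro (_ | _) <;> assumption) (by
      intro x
      by_cases hx : x ∈ s
      · refine ⟨tᶜ, ht.isOpen_compl.mem_nhds (disjoint_left.1 hst hx), ?_⟩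
        rintro (_ | _) (_ | _) ⟨y, hy, hyt⟩ ⟨z, hz, hzt⟩ <;> first | rfl | contradiction
      · refine ⟨sᶜ, hs.isOpen_compl.mem_nhds hx, ?_⟩
        rintro (_ | _) (_ | _) ⟨y, hy, hyt⟩ ⟨z, hz, hzt⟩ <;> first | rfl | contradiction)
  refine ⟨U true, U false, hUo _, hUo _, hU true, hU false, disjoint_left.2 fun x h1 h2 => ?_⟩
  exact Bool.noConfusion (hUd.eq_of_mem h1 h2)

theorem lift_mk_finset_le (hτ : Cardinal.aleph0 ≤ τ)
    (hι : Cardinal.lift.{w} (Cardinal.mk ι) ≤ Cardinal.lift.{v} τ) :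
    Cardinal.lift.{w} (Cardinal.mk (Finset ι)) ≤ Cardinal.lift.{v} τ := by
  rcases finite_or_infinite ι with h | h
  · exact (Cardinal.lift_lt_aleph0.2 (Cardinal.mk_lt_aleph0)).le.trans
      (Cardinal.aleph0_le_lift.2 hτ)
  · rwa [Cardinal.mk_finset_of_infinite]

/-- The points of `A` that lie in at most `n` members of the family `U`. -/
def orderLE (A : Set X) (U : ι → Set X) (n : ℕ) : Set X :=
  {x ∈ A | ∀ s : Finset ι, (∀ i ∈ s, x ∈ U i) → s.card ≤ n}

theorem isClosed_orderLE {A : Set X} (hA : IsClosed A) {U : ι → Set X} (hU : ∀ i, IsOpen (U i))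
    (n : ℕ) : IsClosed (orderLE A U n) := by
  have : orderLE A U n = A ∩ ⋂ (s : Finset ι) (_ : ¬ s.card ≤ n), (⋂ i ∈ s, U i)ᶜ := by
    ext x
    simp only [orderLE, mem_ofPred_eq, mem_inter_iff, mem_iInter, mem_compl_iff]
    exact and_congr_right fun _ => forall_congr' fun s => not_imp_not.symm
  rw [this]
  exact hA.inter (isClosed_iInter fun s => isClosed_iInter fun _ =>
    (isOpen_biInter_finset fun i _ => hU i).isClosed_compl)

/-- Points of `A` outside `G` of order at most `n + 1` have order exactly `n + 1`. Sorted by their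
index sets they form a discrete closed family; on an open expansion, one index per set is a locally
constant choice. -/
theorem IsCollectionwiseNormal.exists_locally_constant_choice_orderLE_succ [Nonempty ι]
    (hX : IsCollectionwiseNormal τ X) (hτ : Cardinal.aleph0 ≤ τ)
    (hι : Cardinal.lift.{w} (Cardinal.mk ι) ≤ Cardinal.lift.{v} τ) {A : Set X} (hA : IsClosed A)
    {U : ι → Set X} (hU : ∀ i, IsOpen (U i)) (hfin : ∀ x ∈ A, {i | x ∈ U i}.Finite) (n : ℕ)
    (G : Set X) (hG : IsOpen G) (hnG : orderLE A U n ⊆ G) :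
    ∃ (l : C(X, ℝ)) (g : X → ι), (∀ x, l x ∈ Icc (0 : ℝ) 1) ∧
      (∀ x, 0 < l x → x ∈ U (g x) ∧ ∀ᶠ z in 𝓝 x, g z = g x) ∧
      ∀ x ∈ orderLE A U (n + 1), x ∈ G ∨ 0 < l x := by
  classical
  have := hX.normalSpace hτ
  set T := orderLE A U (n + 1) \ G with hT
  have hTc : IsClosed T := (isClosed_orderLE hA hU _).sdiff hG
  let C : Finset ι → Set X := fun s => {x ∈ T | ∀ i, x ∈ U i ↔ i ∈ s}
  have hTC : ∀ x ∈ T, ∃ s, x ∈ C s ∧ n + 1 ≤ s.card := by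
    intro x hx
    have hxA : x ∈ A := hx.1.1
    refine ⟨(hfin x hxA).toFinset, ⟨hx, by simp⟩, ?_⟩
    by_contra! hlt
    refine hx.2 (hnG ⟨hxA, fun t ht => ?_⟩)
    refine (Finset.card_le_card (t := (hfin x hxA).toFinset) fun i hi => ?_).trans
      (Nat.lt_succ_iff.1 hlt)
    simpa using ht i hi
  -- Near `x ∈ C t`, points of `T` lie in every `U i` with `i ∈ t`; as `t` already has the maximal
  -- size, their index set is `t`.
  have hnhds : ∀ x, ∃ N ∈ 𝓝 x, ∀ s, (C s ∩ N).Nonempty → x ∈ C s := by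
    intro x
    by_cases hx : x ∈ T
    · obtain ⟨t, ht, htn⟩ := hTC x hx
      refine ⟨⋂ i ∈ t, U i, (isOpen_biInter_finset fun i _ => hU i).mem_nhds
        (mem_iInter₂.2 fun i hi => (ht.2 i).2 hi), ?_⟩
      rintro s ⟨z, hzs, hz⟩
      have hts : t ⊆ s := fun i hi => (hzs.2 i).1 (mem_iInter₂.1 hz i hi)
      have hs : s.card ≤ n + 1 := hzs.1.1.2 s fun i hi => (hzs.2 i).2 hi
      rwa [← Finset.eq_of_subset_of_card_le hts (hs.trans htn)]
    · exact ⟨Tᶜ, hTc.isOpen_compl.mem_nhds hx, fun s ⟨z, hzs, hz⟩ => absurd hzs.1 hz⟩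
  have hCc : ∀ s, IsClosed (C s) := by
    intro s
    rw [← isOpen_compl_iff, isOpen_iff_mem_nhds]
    intro x hx
    obtain ⟨N, hN, h⟩ := hnhds x
    exact mem_of_superset hN fun z hzN hz => hx (h s ⟨z, hz, hzN⟩)
  have hCd : IsDiscreteFamily C := by
    intro x
    obtain ⟨N, hN, h⟩ := hnhds x
    refine ⟨N, hN, fun s t hs ht => Finset.ext fun i => ?_⟩
    rw [← (h s hs).2 i, (h t ht).2 i]
  obtain ⟨O, hOo, hOd, hO⟩ :=
    hX.exists_indexed_open_expansion (lift_mk_finset_le hτ hι) hCc hCd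
  have hsel : ∀ s : Finset ι, ∃ i, s.Nonempty → i ∈ s := fun s => by
    by_cases hs : s.Nonempty
    · exact hs.imp fun i hi _ => hi
    · exact ⟨Classical.arbitrary ι, fun h => absurd h hs⟩
  choose e he using hsel
  have hWo : IsOpen (⋃ s, O s ∩ U (e s)) := isOpen_iUnion fun s => (hOo s).inter (hU _)
  have hTW : T ⊆ ⋃ s, O s ∩ U (e s) := by
    intro x hx
    obtain ⟨s, hs, hn⟩ := hTC x hx
    exact mem_iUnion.2 ⟨s, hO s hs, (hs.2 _).2 (he s (Finset.card_pos.1 (by omega)))⟩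
  obtain ⟨l, hl0, hl1, hl⟩ := exists_continuous_zero_one_of_isClosed hWo.isClosed_compl hTc
    (disjoint_compl_left_iff_subset.2 hTW)
  have hgex : ∀ x, ∃ i, ∀ s, x ∈ O s → i = e s := by
    intro x
    by_cases h : ∃ s, x ∈ O s
    · obtain ⟨s, hs⟩ := h
      exact ⟨e s, fun t ht => congrArg e (hOd.eq_of_mem hs ht)⟩
    · exact ⟨Classical.arbitrary ι, fun s hs => absurd ⟨s, hs⟩ h⟩
  choose g hg using hgex
  refine ⟨l, g, hl, fun x hx => ?_, fun x hx => ?_⟩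
  · have hxW : x ∈ ⋃ s, O s ∩ U (e s) := by
      by_contra hxW
      exact hx.ne' (hl0 hxW)
    obtain ⟨s, hxs, hxU⟩ := mem_iUnion.1 hxW
    refine ⟨(hg x s hxs).symm ▸ hxU, ?_⟩
    filter_upwards [(hOo s).mem_nhds hxs] with z hz
    rw [hg x s hxs, hg z s hz]
  · by_cases hxG : x ∈ G
    · exact Or.inl hxG
    · right
      rw [hl1 (show x ∈ T from ⟨hx, hxG⟩)]
      exact one_pos

/-- A point-finite family of open sets that covers a closed set `A` has, around `A`, a countable
family of locally constant choices of members, defined on cozero sets. -/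
theorem IsCollectionwiseNormal.exists_countable_locally_constant_choice [Nonempty ι]
    (hX : IsCollectionwiseNormal τ X) (hτ : Cardinal.aleph0 ≤ τ)
    (hι : Cardinal.lift.{w} (Cardinal.mk ι) ≤ Cardinal.lift.{v} τ) {A : Set X} (hA : IsClosed A)
    {U : ι → Set X} (hU : ∀ i, IsOpen (U i)) (hcov : A ⊆ ⋃ i, U i)
    (hfin : ∀ x ∈ A, {i | x ∈ U i}.Finite) :
    ∃ (l : ℕ → C(X, ℝ)) (g : ℕ → X → ι), (∀ n x, l n x ∈ Icc (0 : ℝ) 1) ∧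
      (∀ n x, 0 < l n x → x ∈ U (g n x) ∧ ∀ᶠ z in 𝓝 x, g n z = g n x) ∧
      ∀ x ∈ A, ∃ n, 0 < l n x := by
  choose! l g hl hg hlG using
    hX.exists_locally_constant_choice_orderLE_succ hτ hι hA hU hfin
  -- `G n` is the union of the cozero sets found before stage `n`. It may start empty because the
  -- cover leaves no point of order 0 in `A`.
  let G : ℕ → Set X := fun n => Nat.rec ∅ (fun n G => G ∪ {x | 0 < l n G x}) n
  have hGs : ∀ n, G (n + 1) = G n ∪ {x | 0 < l n (G n) x} := fun n => rfl
  have hG : ∀ n, IsOpen (G n) ∧ orderLE A U n ⊆ G n := by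
    intro n
    induction n with
    | zero =>
      refine ⟨isOpen_empty, fun x hx => ?_⟩
      obtain ⟨i, hi⟩ := mem_iUnion.1 (hcov hx.1)
      simpa using hx.2 {i} (by simpa using hi)
    | succ n ih =>
      rw [hGs]
      exact ⟨ih.1.union (isOpen_lt continuous_const (l n (G n)).continuous),
        fun x hx => hlG n (G n) ih.1 ih.2 x hx⟩
  refine ⟨fun n => l n (G n), fun n => g n (G n), fun n x => hl n _ (hG n).1 (hG n).2 x,
    fun n x hx => hg n _ (hG n).1 (hG n).2 x hx, fun x hx => ?_⟩
  have hmem : ∀ n, x ∈ G n → ∃ k, 0 < l k (G k) x := by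
    intro n
    induction n with
    | zero => exact fun h => absurd h (notMem_empty x)
    | succ n ih =>
      rw [hGs]
      rintro (h | h)
      · exact ih h
      · exact ⟨n, h⟩
  refine hmem (hfin x hx).toFinset.card ((hG _).2
    ⟨hx, fun s hs => Finset.card_le_card fun i hi => ?_⟩)
  simpa using hs i hi

end CollectionwiseNormal

/-! ### Gluing over countable cozero covers -/

section Gluing

variable {X E : Type*} [TopologicalSpace X]

/-- A countable cover by cozero sets has a locally finite refinement by open sets. -/
theorem exists_locallyFinite_refinement_of_cozero {l : ℕ → C(X, ℝ)}
    (hl : ∀ n x, l n x ∈ Icc (0 : ℝ) 1) (hcov : ∀ x, ∃ n, 0 < l n x) :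
    ∃ V : ℕ → Set X, (∀ n, IsOpen (V n)) ∧ LocallyFinite V ∧ (⋃ n, V n) = univ ∧
      ∀ n, ∀ x ∈ V n, 0 < l n x := by
  classical
  have hsum : ∀ (n : ℕ) x, 0 ≤ (n : ℝ) * ∑ k ∈ Finset.range n, l k x := fun n x =>
    mul_nonneg n.cast_nonneg (Finset.sum_nonneg fun k _ => (hl k x).1)
  -- The first `n` with `l n x > 0` has zero earlier sum, so these sets cover. Near `x` the factor
  -- `n` eventually pushes the left side above 1, so only finitely many meet a neighbourhood.
  refine ⟨fun n => {x | (n : ℝ) * ∑ k ∈ Finset.range n, l k x < l n x}, fun n => ?_, fun x => ?_,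
    eq_univ_of_forall fun x => ?_, fun n x hx => (hsum n x).trans_lt hx⟩
  · exact isOpen_lt (by fun_prop) (l n).continuous
  · obtain ⟨k, hk⟩ := hcov x
    obtain ⟨m, hm⟩ := exists_nat_gt (2 / l k x)
    refine ⟨{z | l k x / 2 < l k z},
      (isOpen_lt continuous_const (l k).continuous).mem_nhds (half_lt_self hk),
      (finite_lt_nat (max m (k + 1))).subset ?_⟩
    rintro n ⟨z, hzn, hz⟩
    by_contra hn
    rw [mem_ofPred_eq, not_lt, max_le_iff] at hn
    obtain ⟨hmn, hkn⟩ := hn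
    simp only [mem_ofPred_eq] at hzn hz
    have h1 : l k z ≤ ∑ j ∈ Finset.range n, l j z :=
      Finset.single_le_sum (f := fun j => l j z) (fun j _ => (hl j z).1)
        (Finset.mem_range.2 hkn)
    have h2 : (m : ℝ) ≤ n := Nat.cast_le.2 hmn
    have h3 : 1 < (m : ℝ) * (l k x / 2) := by
      rw [div_lt_iff₀ hk] at hm
      linarith
    have h4 : (m : ℝ) * (l k x / 2) ≤ n * ∑ j ∈ Finset.range n, l j z :=
      mul_le_mul h2 (hz.le.trans h1) (half_pos hk).le n.cast_nonneg
    linarith [(hl n z).2]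
  · refine mem_iUnion.2 ⟨Nat.find (hcov x), ?_⟩
    have h0 : ∑ k ∈ Finset.range (Nat.find (hcov x)), l k x = 0 :=
      Finset.sum_eq_zero fun k hk =>
        le_antisymm (not_lt.1 (Nat.find_min (hcov x) (Finset.mem_range.1 hk))) (hl k x).1
    simpa [h0] using Nat.find_spec (hcov x)

theorem exists_continuous_mem_convex_of_cozero [NormalSpace X] [AddCommGroup E] [Module ℝ E]
    [TopologicalSpace E] [ContinuousAdd E] [ContinuousSMul ℝ E] {l : ℕ → C(X, ℝ)}
    (hl : ∀ n x, l n x ∈ Icc (0 : ℝ) 1) (hcov : ∀ x, ∃ n, 0 < l n x) {S : X → Set E}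
    (hS : ∀ x, Convex ℝ (S x)) {f : ℕ → X → E} (hf : ∀ n x, 0 < l n x → ContinuousAt (f n) x)
    (hfS : ∀ n x, 0 < l n x → f n x ∈ S x) :
    ∃ g : X → E, Continuous g ∧ ∀ x, g x ∈ S x := by
  obtain ⟨V, hVo, hVf, hVc, hV⟩ := exists_locallyFinite_refinement_of_cozero hl hcov
  obtain ⟨ρ, hρ⟩ :=
    PartitionOfUnity.exists_isSubordinate_of_locallyFinite isClosed_univ V hVo hVf hVc.ge
  refine ⟨fun x => ∑ᶠ n, ρ n x • f n x,
    ρ.continuous_finsum_smul fun n x hx => hf n x (hV n x (hρ n hx)), fun x =>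
    ρ.finsum_smul_mem_convex (mem_univ x) (fun n hn => hfS n x (hV n x (hρ n ?_))) (hS x)⟩
  exact subset_tsupport _ hn

end Gluing

theorem LowerHemicontinuous.inter_ball {X E : Type*} [TopologicalSpace X] [PseudoMetricSpace E]
    {ψ : X → Set E} (hψ : LowerHemicontinuous ψ) {f : X → E} (hf : Continuous f) (δ : ℝ) :
    LowerHemicontinuous fun x => ψ x ∩ Metric.ball (f x) δ := by
  rw [lowerHemicontinuous_iff_isOpen_inter_nonempty] at hψ ⊢
  intro u hu
  rw [isOpen_iff_mem_nhds]
  rintro x ⟨y, ⟨hyψ, hyδ⟩, hyu⟩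
  rw [Metric.mem_ball] at hyδ
  -- The slack in `dist y (f x) < δ` is split between moving `y` and moving `f x`.
  have hr : 0 < (δ - dist y (f x)) / 2 := by linarith
  set r := (δ - dist y (f x)) / 2 with hrdef
  filter_upwards [(hψ (u ∩ Metric.ball y r) (hu.inter Metric.isOpen_ball)).mem_nhds
    ⟨y, hyψ, hyu, Metric.mem_ball_self hr⟩,
    hf.continuousAt.eventually (Metric.ball_mem_nhds (f x) hr)] with z hz hfz
  obtain ⟨p, hpψ, hpu, hpy⟩ := hz
  refine ⟨p, ⟨hpψ, ?_⟩, hpu⟩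
  rw [Metric.mem_ball] at hpy ⊢
  have h1 := dist_triangle4 p y (f x) (f z)
  rw [dist_comm (f x)] at h1
  linarith

/-! ### Approximate selections and their limit -/

section Selection

variable {X : Type u} [TopologicalSpace X] {τ : Cardinal.{w}} {E : Type v}

theorem exists_denseRange_of_topologicalWeight_le [TopologicalSpace E] [Nonempty E]
    (hE : Cardinal.lift.{w} (topologicalWeight E) ≤ Cardinal.lift.{v} τ) :
    ∃ (ι : Type v) (d : ι → E), DenseRange d ∧
      Cardinal.lift.{w} (Cardinal.mk ι) ≤ Cardinal.lift.{v} τ := by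
  obtain ⟨B, hB, hBE⟩ : topologicalWeight E ∈ {κ | ∃ B : Set (Set E),
      TopologicalSpace.IsTopologicalBasis B ∧ Cardinal.mk B = κ} :=
    csInf_mem ⟨_, _, TopologicalSpace.isTopologicalBasis_opens, rfl⟩
  have hd : ∀ b : B, ∃ y : E, (b : Set E).Nonempty → y ∈ (b : Set E) := fun b => by
    by_cases hb : (b : Set E).Nonempty
    · exact hb.imp fun y hy _ => hy
    · exact ⟨Classical.arbitrary E, fun h => absurd h hb⟩
  choose d hd using hd
  refine ⟨B, d, ?_, hBE ▸ hE⟩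
  rw [DenseRange, hB.dense_iff]
  exact fun b hb hne => ⟨d ⟨b, hb⟩, hd ⟨b, hb⟩ hne, mem_range_self _⟩

variable [NormedAddCommGroup E] [NormedSpace ℝ E]

/-- An `ε`-approximate selection exists as soon as `ψ x` is relatively compact at every point
where a given continuous map fails to select from `ψ`. -/
theorem IsCollectionwiseNormal.exists_continuous_mem_thickening (hX : IsCollectionwiseNormal τ X)
    (hτ : Cardinal.aleph0 ≤ τ)
    (hE : Cardinal.lift.{w} (topologicalWeight E) ≤ Cardinal.lift.{v} τ)
    {ψ : X → Set E} (hψ : LowerHemicontinuous ψ) (hne : ∀ x, (ψ x).Nonempty)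
    (hconv : ∀ x, Convex ℝ (ψ x)) {f : X → E} (hf : Continuous f)
    (h : ∀ x, f x ∈ ψ x ∨ ∃ K, IsCompact K ∧ ψ x ⊆ K) {ε : ℝ} (hε : 0 < ε) :
    ∃ g : X → E, Continuous g ∧ ∀ x, g x ∈ Metric.thickening ε (ψ x) := by
  have := hX.normalSpace hτ
  obtain ⟨ι, d, hd, hι⟩ := exists_denseRange_of_topologicalWeight_le hE
  have : Nonempty ι := hd.nonempty_iff.2 ⟨0⟩
  obtain ⟨V, hVo, hVc, hVf, hV⟩ := precise_refinement (fun i => Metric.ball (d i) ε)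
    (fun i => Metric.isOpen_ball) (eq_univ_of_forall fun y => by
      obtain ⟨i, hi⟩ := hd.exists_dist_lt y hε
      exact mem_iUnion.2 ⟨i, hi⟩)
  have hO : IsOpen {x | f x ∈ Metric.thickening ε (ψ x)} := by
    have := lowerHemicontinuous_iff_isOpen_inter_nonempty.1 (hψ.inter_ball hf ε) univ isOpen_univ
    convert this using 1
    ext x
    simp only [inter_univ, mem_ofPred_eq, Metric.mem_thickening_iff, Set.Nonempty, mem_inter_iff,
      Metric.mem_ball, dist_comm (f x)]
  have hA : IsClosed {x | f x ∈ Metric.thickening ε (ψ x)}ᶜ := hO.isClosed_compl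
  obtain ⟨l, g, hl, hg, hlA⟩ := hX.exists_countable_locally_constant_choice hτ hι hA
    (U := fun i => {x | (ψ x ∩ V i).Nonempty})
    (fun i => lowerHemicontinuous_iff_isOpen_inter_nonempty.1 hψ _ (hVo i))
    (fun x _ => by
      obtain ⟨y, hy⟩ := hne x
      obtain ⟨i, hi⟩ := mem_iUnion.1 (hVc.ge (mem_univ y))
      exact mem_iUnion.2 ⟨i, y, hy, hi⟩)
    (fun x hx => by
      rcases h x with hfx | ⟨K, hK, hψK⟩
      · exact absurd (Metric.self_subset_thickening hε _ hfx) hx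
      · refine (hVf.finite_nonempty_inter_compact hK).subset ?_
        rintro i ⟨y, hy, hyV⟩
        exact ⟨y, hyV, hψK hy⟩)
  have hGo : IsOpen (⋃ n, {x | 0 < l n x}) :=
    isOpen_iUnion fun n => isOpen_lt continuous_const (l n).continuous
  obtain ⟨l₀, hl₀0, hl₀1, hl₀⟩ := exists_continuous_zero_one_of_isClosed hA hGo.isClosed_compl
    (disjoint_compl_right_iff_subset.2 fun x hx => mem_iUnion.2 (hlA x hx))
  -- Index 0 carries the old map `f`, weighted by `l₀`, which vanishes where `f` fails; the shifted
  -- indices carry the new choices.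
  refine exists_continuous_mem_convex_of_cozero (l := fun n => Nat.casesOn n l₀ l)
    (f := fun n => Nat.casesOn n f fun n x => d (g n x))
    ?_ (fun x => ?_) (fun x => (hconv x).thickening ε) ?_ ?_
  · rintro (_ | n)
    exacts [hl₀, hl n]
  · by_cases hx : x ∈ ⋃ n, {x | 0 < l n x}
    · obtain ⟨n, hn⟩ := mem_iUnion.1 hx
      exact ⟨n + 1, hn⟩
    · refine ⟨0, ?_⟩
      change 0 < l₀ x
      rw [hl₀1 hx]
      exact one_pos
  · rintro (_ | n) x hx
    · exact hf.continuousAt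
    · refine (continuousAt_const (y := d (g n x))).congr ?_
      filter_upwards [(hg n x hx).2] with z hz
      exact (congrArg d hz).symm
  · rintro (_ | n) x hx
    · by_contra hxA
      exact hx.ne' (hl₀0 hxA)
    · obtain ⟨y, hy, hyV⟩ := (hg n x hx).1
      exact Metric.mem_thickening_iff.2 ⟨y, hy, Metric.mem_ball'.1 (hV _ hyV)⟩

end Selection

theorem theorem3p1 (τ : Cardinal.{w}) (hτ : Cardinal.aleph0 ≤ τ)
    (X : Type u) [TopologicalSpace X] (hX : IsCollectionwiseNormal τ X)
    (E : Type v) [NormedAddCommGroup E] [NormedSpace ℝ E] [CompleteSpace E]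
    (hE : Cardinal.lift.{w} (topologicalWeight E) ≤ Cardinal.lift.{v} τ)
    (φ : X → Set E) (hφ : ∀ x, φ x ∈ nonemptyCompactSetsOrUniv E)
    (hconv : ∀ x, Convex ℝ (φ x))
    (hlsc : LowerHemicontinuous φ) :
    ∃ f : X → E, Continuous f ∧ ∀ x, f x ∈ φ x := by
  have hφ' : ∀ x, φ x = univ ∨ IsCompact (φ x) := fun x => (hφ x).elim (fun h => .inr h.2) .inl
  have hne : ∀ x, (φ x).Nonempty := fun x =>
    (hφ x).elim And.left fun h => by rw [mem_singleton_iff.1 h]; exact univ_nonempty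
  have hcl : ∀ x, IsClosed (φ x) := fun x =>
    (hφ' x).elim (fun h => h ▸ isClosed_univ) IsCompact.isClosed
  have hpos : ∀ n : ℕ, (0 : ℝ) < (1 / 2) ^ n := fun n => by positivity
  obtain ⟨f₀, hf₀, hf₀φ⟩ := hX.exists_continuous_mem_thickening hτ hE hlsc hne hconv
    (continuous_const (y := (0 : E)))
    (fun x => (hφ' x).imp (fun h => by simp [h]) fun h => ⟨_, h, Subset.rfl⟩) (hpos 0)
  have hstep : ∀ (n : ℕ) (f : {f : X → E // Continuous f ∧
      ∀ x, f x ∈ Metric.thickening ((1 / 2) ^ n) (φ x)}),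
      ∃ g : {f : X → E // Continuous f ∧ ∀ x, f x ∈ Metric.thickening ((1 / 2) ^ (n + 1)) (φ x)},
        ∀ x, dist (f.1 x) (g.1 x) ≤ 2 * (1 / 2) ^ n := by
    rintro n ⟨f, hf, hfφ⟩
    obtain ⟨g, hg, hgφ⟩ := hX.exists_continuous_mem_thickening hτ hE
      (hlsc.inter_ball hf ((1 / 2) ^ n))
      (fun x => by
        obtain ⟨y, hy, hxy⟩ := Metric.mem_thickening_iff.1 (hfφ x)
        exact ⟨y, hy, Metric.mem_ball'.2 hxy⟩)
      (fun x => (hconv x).inter (convex_ball _ _)) hf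
      -- Where `φ x` is all of `E`, the old value is the centre of the ball and so already selects;
      -- elsewhere the intersection lies in the compact `φ x`.
      (fun x => (hφ' x).imp (fun h => ⟨by simp [h], Metric.mem_ball_self (hpos n)⟩)
        fun h => ⟨_, h, inter_subset_left⟩) (hpos (n + 1))
    refine ⟨⟨g, hg, fun x => Metric.thickening_subset_of_subset _ inter_subset_left (hgφ x)⟩,
      fun x => ?_⟩
    obtain ⟨y, ⟨-, hy⟩, hxy⟩ := Metric.mem_thickening_iff.1 (hgφ x)
    have h1 := dist_triangle_right (f x) (g x) y
    rw [Metric.mem_ball, dist_comm] at hy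
    have h2 := hpos n
    rw [pow_succ] at hxy
    change dist (f x) (g x) ≤ _
    linarith
  choose next hnext using hstep
  let F : ∀ n : ℕ, {f : X → E // Continuous f ∧
      ∀ x, f x ∈ Metric.thickening ((1 / 2) ^ n) (φ x)} :=
    fun n => Nat.rec ⟨f₀, hf₀, hf₀φ⟩ next n
  have hF : ∀ x n, dist ((F n).1 x) ((F (n + 1)).1 x) ≤ 2 * (1 / 2) ^ n := fun x n =>
    hnext n (F n) x
  have hlim : ∀ x, ∃ y, Tendsto (fun n => (F n).1 x) atTop (𝓝 y) := fun x =>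
    cauchySeq_tendsto_of_complete (cauchySeq_of_le_geometric _ _ (by norm_num) (hF x))
  choose f hfF using hlim
  have hdist : ∀ x n, dist ((F n).1 x) (f x) ≤ 4 * (1 / 2) ^ n := fun x n => by
    refine (dist_le_of_le_geometric_of_tendsto _ _ (by norm_num) (hF x) (hfF x) n).trans_eq ?_
    ring
  -- 5 is 4 for the distance to the limit plus 1 for the distance to `φ x`.
  have hsmall : ∀ ε > (0 : ℝ), ∀ᶠ n : ℕ in atTop, 5 * (1 / 2 : ℝ) ^ n < ε := fun ε hε => by
    have h := (tendsto_pow_atTop_nhds_zero_of_lt_one (r := (1 / 2 : ℝ)) (by norm_num)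
      (by norm_num)).const_mul 5
    rw [mul_zero] at h
    exact h.eventually_lt_const hε
  refine ⟨f, ?_, fun x => ?_⟩
  · have hunif : TendstoUniformly (fun n x => (F n).1 x) f atTop := by
      rw [Metric.tendstoUniformly_iff]
      intro ε hε
      filter_upwards [hsmall ε hε] with n hn x
      rw [dist_comm]
      linarith [hdist x n, hpos n]
    exact hunif.continuous (Frequently.of_forall fun n => (F n).2.1)
  · rw [← (hcl x).closure_eq, Metric.mem_closure_iff]
    intro ε hε
    obtain ⟨n, hn⟩ := (hsmall ε hε).exists
    obtain ⟨y, hy, hxy⟩ := Metric.mem_thickening_iff.1 ((F n).2.2 x)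
    refine ⟨y, hy, ?_⟩
    linarith [dist_triangle_left (f x) y ((F n).1 x), hdist x n]
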